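/- Let $\mathsf{R}=(\mathbb{R}\cup\{\infty\},\oplus,\otimes)$ and $\mathsf{R}^{+}=(\mathbb{R}_{\ge 0}\cup\{\infty\},\oplus,\otimes)$ be the min-plus semirings, where $\oplus$ is the minimum (with identity $\infty$) and $\otimes$ is the usual addition (with identity $0$). Let $S$ be one of them. A model of computation is said to compute a polynomial $f$ over $S$ if it produces a polynomial that defines the same function as $f$ on all inputs from $S$. A $p$-family is a sequence $(f_n)_{n\ge 1}$ of polynomials over $S$ whose number of variables and degree are bounded by polynomials in $n$. $\mathsf{VP}_S$ is the class of $p$-families computed by arithmetic circuits over $S$ of size polynomial in $n$. An algebraic branching program (ABP) is a layered directed acyclic graph with a source and a sink, whose edges go from a layer to the next one and are labelled with a variable or a constant of $S$; it produces the $\oplus$, over all source-to-sink paths, of the $\otimes$-product of the edge labels; its width is the maximum number of nodes in a layer. For a class $\mathcal{K}$ of $p$-families, the hypercube sums over $\mathcal{K}$ are the $p$-families $(f_n)_{n\ge 1}$ for which there are a family $(g_n)_{n\ge 1}\in\mathcal{K}$ and polynomials $p(n), q(n)$ such that for all $n\ge 1$, as functions, $$f_n(X)=\bigoplus_{y_1,\ldots,y_{q(n)}\in\{\infty,0\}}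 g_{p(n)}\big(X,y_1,\ldots,y_{q(n)},\overline{y_1},\ldots,\overline{y_{q(n)}}\big),$$ where $\overline{\infty}=0$ and $\overline{0}=\infty$. Let $\mathsf{VNP}_S$ be the class of hypercube sums over $\mathsf{VP}_S$, and let $\mathsf{VNBP}_{2,S}$ be the class of hypercube sums over the class of $p$-families computed by width-$2$ ABPs over $S$ of size polynomial in $n$. Then $\mathsf{VNP}_{\mathsf{R}}=\mathsf{VNBP}_{2,\mathsf{R}}$ and $\mathsf{VNP}_{\mathsf{R}^{+}}=\mathsf{VNBP}_{2,\mathsf{R}^{+}}$. -/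

import Mathlib

namespace MinPlus

open MvPolynomial

/-- The min-plus semiring on `ℝ ∪ {∞}`: addition is `min`, multiplication is `+`,
the zero is `∞` and the one is `0`. -/
abbrev R : Type := Tropical (WithTop ℝ)

/-- The min-plus semiring on `ℝ≥0 ∪ {∞}`. -/
abbrev RPlus : Type := Tropical (WithTop NNReal)

section

variable {S : Type} [CommSemiring S]

/-- Two polynomials define the same function `S ^ v → S`. -/
def SameFunction {v : ℕ} (f g : MvPolynomial (Fin v) S) : Prop :=
  ∀ x : Fin v → S, eval x f = eval x g

variable (S) in
/-- A sequence `(f_n)_{n ≥ 1}` of polynomials, `f_n` being a polynomial in `arity n` variables. -/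
structure PolyFamily where
  arity : ℕ+ → ℕ
  poly : (n : ℕ+) → MvPolynomial (Fin (arity n)) S

/-- A function on the positive integers is bounded by a polynomial function. -/
def PolyBounded (s : ℕ+ → ℕ) : Prop :=
  ∃ P : Polynomial ℕ, ∀ n : ℕ+, s n ≤ P.eval (n : ℕ)

/-- A `p`-family: the number of variables and the degree are polynomially bounded. -/
def PolyFamily.IsPFamily (f : PolyFamily S) : Prop :=
  PolyBounded f.arity ∧ PolyBounded (fun n => (f.poly n).totalDegree)

/-! ### Circuits -/

variable (S) in
/-- A gate of a circuit in `v` variables, which may refer to the `k` gates that precede it. -/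
inductive Gate (v k : ℕ) : Type
  | var (i : Fin v) : Gate v k
  | const (c : S) : Gate v k
  | sum (a b : Fin k) : Gate v k
  | prod (a b : Fin k) : Gate v k

variable (S) in
/-- An arithmetic circuit over `S` in `v` variables: a directed acyclic graph of gates, in
topological order, with a designated output gate. Leaves are labelled by variables or constants,
inner gates have fan-in two and arbitrary fan-out. The size is the number of gates. -/
structure Circuit (v : ℕ) where
  size : ℕ
  gate : (k : Fin size) → Gate S v k
  output : Fin size

/-- The polynomial computed at gate `k`. -/
noncomputable def Circuit.polyAt {v : ℕ} (C : Circuit S v) (k : Fin C.size) :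
    MvPolynomial (Fin v) S :=
  match C.gate k with
  | .var i => X i
  | .const c => MvPolynomial.C c
  | .sum a b => C.polyAt ⟨a, a.2.trans k.2⟩ + C.polyAt ⟨b, b.2.trans k.2⟩
  | .prod a b => C.polyAt ⟨a, a.2.trans k.2⟩ * C.polyAt ⟨b, b.2.trans k.2⟩
termination_by k.val
decreasing_by all_goals exact Fin.is_lt _

/-- The polynomial computed by a circuit. -/
noncomputable def Circuit.poly {v : ℕ} (C : Circuit S v) : MvPolynomial (Fin v) S :=
  C.polyAt C.output

variable (S) in
/-- `VP`: the `p`-families computed (as functions) by circuits of polynomially bounded size. -/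
def VP : Set (PolyFamily S) :=
  {f | f.IsPFamily ∧ ∃ C : (n : ℕ+) → Circuit S (f.arity n),
    PolyBounded (fun n => (C n).size) ∧ ∀ n, SameFunction (C n).poly (f.poly n)}

/-! ### Algebraic branching programs -/

variable (S) in
/-- An edge label: a variable or a constant. -/
inductive Label (v : ℕ) : Type
  | var (i : Fin v) : Label v
  | const (c : S) : Label v

/-- An edge label, as a polynomial. -/
noncomputable def Label.poly {v : ℕ} : Label S v → MvPolynomial (Fin v) S
  | .var i => X i
  | .const c => MvPolynomial.C c

variable (S) in
/-- A (weakest) algebraic branching program of width `w` in `v` variables. It has layers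
`0, …, length` of `w` nodes each (a layer with fewer nodes is filled up with isolated nodes), and
edges from each layer to the next one, labelled with a variable or a constant. An absent edge is the
same as an edge labelled with the zero of `S`, which is `∞` in the min-plus semirings. -/
structure ABP (w v : ℕ) where
  length : ℕ
  label : Fin length → Fin w → Fin w → Label S v
  source : Fin w
  sink : Fin w

/-- The number of nodes. -/
def ABP.size {w v : ℕ} (A : ABP S w v) : ℕ := w * (A.length + 1)

/-- The weight of a path that visits node `π i` of layer `i`: the product of its edge labels. -/
noncomputable def ABP.weight {w v : ℕ} (A : ABP S w v) (π : Fin (A.length + 1) → Fin w) :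
    MvPolynomial (Fin v) S :=
  ∏ i : Fin A.length, (A.label i (π i.castSucc) (π i.succ)).poly

/-- The polynomial computed by an ABP: the sum of the weights of the source-to-sink paths, from
`source` in the first layer to `sink` in the last one. -/
noncomputable def ABP.poly {w v : ℕ} (A : ABP S w v) : MvPolynomial (Fin v) S :=
  ∑ π : Fin (A.length + 1) → Fin w,
    if π 0 = A.source ∧ π (Fin.last A.length) = A.sink then A.weight π else 0

variable (S) in
/-- The `p`-families computed (as functions) by width-`w` ABPs of polynomially bounded size. -/
def VBP (w : ℕ) : Set (PolyFamily S) :=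
  {f | f.IsPFamily ∧ ∃ A : (n : ℕ+) → ABP S w (f.arity n),
    PolyBounded (fun n => (A n).size) ∧ ∀ n, SameFunction (A n).poly (f.poly n)}

/-! ### Hypercube sums with complemented hypercube variables -/

/-- The two Boolean values of `S`: the one (`0` in the min-plus semirings) for `true` and the zero
(`∞` in the min-plus semirings) for `false`. -/
def bit (b : Bool) : S := if b then 1 else 0

/-- The point `(X, y_1, …, y_q, ȳ_1, …, ȳ_q)` at `X = x`, with Boolean values `y` given by `b` and
complementary values `ȳ`. -/
def hypercubePoint {v q : ℕ} (x : Fin v → S) (b : Fin q → Bool) : Fin v ⊕ Fin q ⊕ Fin q → S :=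
  Sum.elim x (Sum.elim (fun j => bit (b j)) (fun j => bit (!(b j))))

/-- The `p`-families `f` such that, for some family `g` in the class `K` and polynomials `p`, `q`,
`f_n(X)` is the sum of `g_{p(n)}(X, y_1, …, y_{q(n)}, ȳ_1, …, ȳ_{q(n)})` over all Boolean values of
`y_1, …, y_{q(n)}`. The bijection `e` names the variables of `g_{p(n)}`. -/
def hypercubeSums (K : Set (PolyFamily S)) : Set (PolyFamily S) :=
  {f | f.IsPFamily ∧ ∃ g ∈ K, ∃ p q : Polynomial ℕ, ∀ n : ℕ+,
    ∃ m : ℕ+, (m : ℕ) = p.eval (n : ℕ) ∧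
    ∃ e : Fin (g.arity m) ≃
        Fin (f.arity n) ⊕ Fin (q.eval (n : ℕ)) ⊕ Fin (q.eval (n : ℕ)),
      ∀ x : Fin (f.arity n) → S,
        eval x (f.poly n) =
          ∑ b : Fin (q.eval (n : ℕ)) → Bool,
            eval (fun i => hypercubePoint x b (e i)) (g.poly m)}

variable (S) in
/-- `VNP`, with complements of the hypercube variables. -/
def VNP : Set (PolyFamily S) := hypercubeSums (VP S)

variable (S) in
/-- `VNBP_w`: hypercube sums over families with polynomial-size width-`w` ABPs. -/
def VNBP (w : ℕ) : Set (PolyFamily S) := hypercubeSums (VBP S w)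

end

end MinPlus

/-!
Width-two branching programs are circuits, so only `VNP ⊆ VNBP 2` has content. The argument works in
every `MinSemiring`, and it computes `eval z g`, for a polynomial `g` of degree at most `d` given by
a circuit `C`, as the minimal weight of a Boolean assignment subject to clauses.

* `MinSemiring.exists_eval_monomial_le`: the polynomial of `C` may have exponential degree although
  it defines the same function as `g`, but at every point its minimum is attained by a monomial of
  degree at most `d`. This follows by increasing all variables by a small amount.
* `Circuit.exists_derives`: a monomial of degree `d` at a gate of `C` stems from a parse tree of
  polynomial size, provided that gates may be replaced by their constant coefficients. Parse trees
  are those of a weighted grammar, `Circuit.grammar`.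
* `Grammar.exists_cnf`: a parse tree is written as the word of its nodes in preorder, where each
  node records the sizes of its subtree and of the subtree at its first child. Whether a word
  encodes a parse tree is then a conjunction of constraints on pairs of positions, hence a formula in
  conjunctive normal form in the variables "the symbol at position `i` is `x`".
* `exists_abp_cnf`: width two suffices to multiply by a sum of labels, and by `ȳ + y * ℓ`, and thus
  to check the clauses and to pay a label `ℓ` for every variable `y` which is true.

The sum over the assignments is a hypercube sum. It can be merged with the given one, and padded
with unused variables to make their number a polynomial, because addition is idempotent
(`exists_abp_hypercube_sum`).
-/

namespace MinPlus

open MvPolynomial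

/-! ### Semirings with minimum as addition -/

/-- A semiring whose addition is the minimum of a linear order, and in which all points can be
shifted by an arbitrarily small amount: if `a < b` then there is some `ε ≥ 1` with `a * ε ^ d < b`
such that multiplying `a` by a higher power of `ε` gives a larger result. -/
class MinSemiring (S : Type) [CommSemiring S] [LinearOrder S] : Prop where
  add_eq_min : ∀ a b : S, a + b = min a b
  exists_shift : ∀ (a b : S) (d : ℕ), a < b →
    ∃ ε : S, 1 ≤ ε ∧ a * ε ^ d < b ∧ ∀ k, d < k → a * ε ^ d < a * ε ^ k

theorem bit_mul_bit {S : Type} [CommSemiring S] (a b : Bool) :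
    (bit a : S) * bit b = bit (a && b) := by
  cases a <;> cases b <;> simp [bit]

namespace MinSemiring

variable {S : Type} [CommSemiring S] [LinearOrder S] [MinSemiring S]

theorem le_zero (a : S) : a ≤ 0 := by
  have h := add_eq_min a 0
  rw [add_zero] at h
  exact h ▸ min_le_right a 0

theorem mul_le_mul_left_of_le {b c : S} (a : S) (h : b ≤ c) : a * b ≤ a * c := by
  have h1 : b + c = b := by rw [add_eq_min, min_eq_left h]
  have h2 : a * b + a * c = a * b := by rw [← mul_add, h1]
  rw [← h2, add_eq_min]
  exact min_le_right _ _

theorem mul_le_mul_of_le {a b c d : S} (h : a ≤ b) (h' : c ≤ d) : a * c ≤ b * d :=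
  (mul_le_mul_left_of_le a h').trans (by
    rw [mul_comm a, mul_comm b]; exact mul_le_mul_left_of_le d h)

theorem one_le_pow {a : S} (h : 1 ≤ a) (n : ℕ) : 1 ≤ a ^ n := by
  induction n with
  | zero => simp
  | succ n ih => rw [pow_succ]; simpa using mul_le_mul_of_le ih h

theorem le_mul_of_one_le {a b : S} (h : 1 ≤ b) : a ≤ a * b := by
  simpa using mul_le_mul_left_of_le a h

theorem sum_le {ι : Type*} {s : Finset ι} (f : ι → S) {i : ι} (hi : i ∈ s) :
    ∑ j ∈ s, f j ≤ f i := by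
  classical
  rw [← Finset.add_sum_erase s f hi, add_eq_min]
  exact min_le_left _ _

theorem le_sum {ι : Type*} {s : Finset ι} {f : ι → S} {a : S} (h : ∀ i ∈ s, a ≤ f i) :
    a ≤ ∑ j ∈ s, f j := by
  classical
  induction s using Finset.induction_on with
  | empty => simpa using le_zero a
  | insert i s hi ih =>
    rw [Finset.sum_insert hi, add_eq_min]
    exact le_min (h i (by simp)) (ih fun j hj => h j (by simp [hj]))

theorem exists_eq_sum_of_ne_zero {ι : Type*} {s : Finset ι} {f : ι → S}
    (h : ∑ j ∈ s, f j ≠ 0) : ∃ i ∈ s, f i = ∑ j ∈ s, f j := by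
  classical
  induction s using Finset.induction_on with
  | empty => simp at h
  | insert i s hi ih =>
    rw [Finset.sum_insert hi, add_eq_min] at *
    rcases le_total (f i) (∑ j ∈ s, f j) with h1 | h1
    · exact ⟨i, by simp, by rw [min_eq_left h1]⟩
    · rw [min_eq_right h1] at h
      obtain ⟨j, hj, hj'⟩ := ih h
      exact ⟨j, by simp [hj], by rw [min_eq_right h1, hj']⟩

theorem one_add_one : (1 : S) + 1 = 1 := by rw [add_eq_min, min_self]

theorem bit_add_bit (a b : Bool) : (bit a : S) + bit b = bit (a || b) := by
  cases a <;> cases b <;> simp [bit, one_add_one]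

/-! ### Truncating polynomials -/

omit [LinearOrder S] [MinSemiring S] in
theorem eval_smul_monomial {v : ℕ} (z : Fin v → S) (ε : S) (m : Fin v →₀ ℕ) (c : S) :
    eval (fun i => z i * ε) (monomial m c) = eval z (monomial m c) * ε ^ m.degree := by
  simp only [eval_monomial, Finsupp.prod, mul_pow, Finset.prod_mul_distrib, mul_assoc,
    Finset.prod_pow_eq_pow_sum, Finsupp.degree_apply]

theorem eval_le_eval_monomial {v : ℕ} (z : Fin v → S) (f : MvPolynomial (Fin v) S)
    (m : Fin v →₀ ℕ) : eval z f ≤ eval z (monomial m (coeff m f)) := by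
  by_cases hm : m ∈ f.support
  · conv_lhs => rw [f.as_sum, map_sum]
    exact sum_le (fun m => eval z (monomial m (coeff m f))) hm
  · rw [notMem_support_iff.mp hm]
    simpa using le_zero _

theorem exists_eval_monomial_eq {v : ℕ} {z : Fin v → S} {f : MvPolynomial (Fin v) S}
    (h : eval z f ≠ 0) : ∃ m ∈ f.support, eval z (monomial m (coeff m f)) = eval z f := by
  rw [f.as_sum, map_sum] at h
  obtain ⟨m, hm, h'⟩ := exists_eq_sum_of_ne_zero h
  refine ⟨m, hm, h'.trans ?_⟩
  conv_rhs => rw [f.as_sum, map_sum]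

/-- If `f` defines the same function as a polynomial of degree at most `d`, then its monomials of
degree at most `d` suffice to define this function. Indeed, when all variables are increased by a
small amount, a monomial of higher degree cannot attain the minimum. -/
theorem exists_eval_monomial_le {v : ℕ} {f g : MvPolynomial (Fin v) S} (hfg : SameFunction f g)
    {z : Fin v → S} (hz : eval z g ≠ 0) :
    ∃ m ∈ f.support, m.degree ≤ g.totalDegree ∧ eval z (monomial m (coeff m f)) ≤ eval z g := by
  classical
  set d := g.totalDegree
  set T := f.support.filter fun m => m.degree ≤ d
  set τ := ∑ m ∈ T, eval z (monomial m (coeff m f)) with hτ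
  rcases le_or_gt τ (eval z g) with h | h
  · have h0 : τ ≠ 0 := fun h0 => hz (le_antisymm (le_zero _) (h0 ▸ h))
    obtain ⟨m, hm, hm'⟩ := exists_eq_sum_of_ne_zero h0
    rw [Finset.mem_filter] at hm
    exact ⟨m, hm.1, hm.2, hm'.trans_le h⟩
  · exfalso
    -- At the point shifted by `ε`, a monomial of `g` bounds the value from above; the monomials of
    -- `f` of degree at most `d` exceed this bound by the choice of `τ`, the others by their slope.
    obtain ⟨ε, h1, h2, h3⟩ := exists_shift _ _ d h
    obtain ⟨m₀, hm₀, hm₀'⟩ := exists_eval_monomial_eq hz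
    have hdeg : m₀.degree ≤ d := by
      simpa [Finsupp.degree_apply, Finsupp.sum] using le_totalDegree hm₀
    have hle : eval (fun i => z i * ε) f ≤ eval z g * ε ^ d := by
      rw [hfg]
      refine (eval_le_eval_monomial _ g m₀).trans ?_
      rw [eval_smul_monomial, hm₀']
      refine mul_le_mul_left_of_le _ ?_
      obtain ⟨k, hk⟩ := Nat.exists_eq_add_of_le hdeg
      rw [hk, pow_add]
      exact le_mul_of_one_le (one_le_pow h1 k)
    have hne : eval (fun i => z i * ε) f ≠ 0 := fun h0 => by
      rw [h0] at hle
      exact absurd (h2.trans_le (le_zero τ)) (not_lt.mpr hle)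
    obtain ⟨m, hm, hm'⟩ := exists_eval_monomial_eq hne
    rw [eval_smul_monomial] at hm'
    rcases le_or_gt m.degree d with hd | hd
    · have h4 : τ ≤ eval z (monomial m (coeff m f)) :=
        sum_le (fun m => eval z (monomial m (coeff m f))) (Finset.mem_filter.mpr ⟨hm, hd⟩)
      have h5 := h4.trans (le_mul_of_one_le (one_le_pow h1 m.degree))
      rw [hm'] at h5
      exact absurd (h5.trans hle) (not_le.mpr h2)
    · have h4 : eval z g ≤ eval z (monomial m (coeff m f)) := by
        rw [← hfg]; exact eval_le_eval_monomial z f m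
      have h5 := mul_le_mul_of_le h4 (le_refl (ε ^ m.degree))
      rw [hm'] at h5
      exact absurd (h5.trans hle) (not_le.mpr (h3 _ hd))

end MinSemiring

/-! ### Min-plus semirings -/

theorem exists_shift_tropical {M : Type} [AddCommMonoid M] [LinearOrder M]
    [IsOrderedCancelAddMonoid M]
    (h : ∀ (a b : M) (d : ℕ), a < b → ∃ ε, 0 < ε ∧ a + d • ε < b) (h1 : ∃ ε : M, 0 < ε)
    (a b : Tropical (WithTop M)) (d : ℕ) (hab : a < b) :
    ∃ ε : Tropical (WithTop M), 1 ≤ ε ∧ a * ε ^ d < b ∧ ∀ k, d < k → a * ε ^ d < a * ε ^ k := by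
  rw [← Tropical.untrop_lt_iff] at hab
  obtain ⟨a', ha⟩ := WithTop.ne_top_iff_exists.mp (ne_top_of_lt hab)
  obtain ⟨ε, hε, hε'⟩ : ∃ ε : M, 0 < ε ∧ ((a' + d • ε : M) : WithTop M) < Tropical.untrop b := by
    rcases eq_or_ne (Tropical.untrop b) ⊤ with hb | hb
    · obtain ⟨ε, hε⟩ := h1
      exact ⟨ε, hε, hb ▸ WithTop.coe_lt_top _⟩
    · obtain ⟨b', hb⟩ := WithTop.ne_top_iff_exists.mp hb
      rw [← ha, ← hb, WithTop.coe_lt_coe] at hab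
      obtain ⟨ε, hε, h'⟩ := h _ _ d hab
      exact ⟨ε, hε, by rw [← hb]; exact WithTop.coe_lt_coe.mpr h'⟩
  have hpow (k : ℕ) : Tropical.untrop (a * Tropical.trop (ε : WithTop M) ^ k) =
      ((a' + k • ε : M) : WithTop M) := by
    rw [Tropical.untrop_mul, Tropical.untrop_pow, ← ha, Tropical.untrop_trop]
    norm_cast
  refine ⟨Tropical.trop (ε : WithTop M), ?_, ?_, fun k hk => ?_⟩
  · rw [← Tropical.untrop_le_iff]; exact WithTop.coe_le_coe.mpr hε.le
  · rwa [← Tropical.untrop_lt_iff, hpow]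
  · rw [← Tropical.untrop_lt_iff, hpow, hpow, WithTop.coe_lt_coe]
    exact add_lt_add_right (nsmul_lt_nsmul_left hε hk) a'

theorem exists_pos_add_nsmul_lt_real (a b : ℝ) (d : ℕ) (h : a < b) :
    ∃ ε, 0 < ε ∧ a + d • ε < b := by
  have hd : (0 : ℝ) < d + 1 := by positivity
  refine ⟨(b - a) / (d + 1), div_pos (sub_pos.mpr h) hd, ?_⟩
  rw [nsmul_eq_mul, ← lt_sub_iff_add_lt', ← mul_div_assoc, div_lt_iff₀ hd]
  nlinarith

theorem exists_pos_add_nsmul_lt_nnreal (a b : NNReal) (d : ℕ) (h : a < b) :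
    ∃ ε, 0 < ε ∧ a + d • ε < b := by
  obtain ⟨ε, h1, h2⟩ := exists_pos_add_nsmul_lt_real a b d h
  lift ε to NNReal using h1.le
  exact ⟨ε, by exact_mod_cast h1, by exact_mod_cast h2⟩

instance : MinSemiring R where
  add_eq_min _ _ := rfl
  exists_shift := exists_shift_tropical exists_pos_add_nsmul_lt_real ⟨1, one_pos⟩

instance : MinSemiring RPlus where
  add_eq_min _ _ := rfl
  exists_shift := exists_shift_tropical exists_pos_add_nsmul_lt_nnreal ⟨1, one_pos⟩

/-! ### Branching programs -/

section
variable {S : Type} [CommSemiring S]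

open Matrix in
/-- The sum over all paths through a layered graph, computed layer by layer. -/
theorem sum_paths_eq {w : ℕ} : ∀ (l : ℕ) (W : Fin l → Matrix (Fin w) (Fin w) S) (u t : Fin w → S),
    ∑ π : Fin (l + 1) → Fin w,
        u (π 0) * (∏ i, W i (π i.castSucc) (π i.succ)) * t (π (Fin.last l)) =
      ∑ j, (List.ofFn W).foldl (fun u M => u ᵥ* M) u j * t j
  | 0, W, u, t => by
    rw [← (Equiv.funUnique (Fin 1) (Fin w)).sum_comp]
    simp [Fin.default_eq_zero]
  | l + 1, W, u, t => by
    rw [List.ofFn_succ, List.foldl_cons, ← sum_paths_eq l,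
      ← (Fin.consEquiv fun _ => Fin w).sum_comp, Fintype.sum_prod_type_right]
    refine Finset.sum_congr rfl fun π _ => ?_
    simp only [Matrix.vecMul, dotProduct, Finset.sum_mul]
    refine Finset.sum_congr rfl fun a _ => ?_
    rw [Fin.prod_univ_succ]
    simp [Fin.consEquiv, ← Fin.succ_last, Fin.castSucc_succ, mul_assoc]

/-- The matrix of a layer of edges. -/
noncomputable def layerMatrix {w v : ℕ} (M : Fin w → Fin w → Label S v) :
    Matrix (Fin w) (Fin w) (MvPolynomial (Fin v) S) :=
  Matrix.of fun a b => (M a b).poly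

open Matrix in
theorem ABP.poly_eq {w v : ℕ} (A : ABP S w v) :
    A.poly = ((List.ofFn A.label).map layerMatrix).foldl
      (fun u M => u ᵥ* M) (Pi.single A.source 1) A.sink := by
  have h := sum_paths_eq A.length (fun i => layerMatrix (A.label i))
    (Pi.single A.source 1) (Pi.single A.sink 1)
  rw [Finset.sum_eq_single A.sink (by simp +contextual) (by simp), Pi.single_eq_same, mul_one] at h
  rw [List.map_ofFn]
  refine Eq.trans ?_ h
  refine Finset.sum_congr rfl fun π _ => ?_
  by_cases h1 : π 0 = A.source <;> by_cases h2 : π (Fin.last _) = A.sink <;>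
    simp [h1, h2, ABP.weight, layerMatrix]

theorem Label.totalDegree_poly_le {v : ℕ} (ℓ : Label S v) : ℓ.poly.totalDegree ≤ 1 := by
  cases ℓ with
  | var i => 
    rw [Label.poly, X]
    exact (totalDegree_monomial_le _ _).trans (by simp)
  | const c => simp [Label.poly]

theorem ABP.totalDegree_poly_le {w v : ℕ} (A : ABP S w v) : A.poly.totalDegree ≤ A.length := by
  refine totalDegree_finsetSum_le fun π _ => ?_
  split_ifs
  · refine (totalDegree_finsetProd _ _).trans ?_
    refine (Finset.sum_le_card_nsmul _ _ 1 fun i _ => Label.totalDegree_poly_le _).trans ?_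
    simp
  · simp
/-! ### Circuits for branching programs -/

/-- The circuit with one more gate, which becomes the output. -/
def Circuit.snoc {v : ℕ} (C : Circuit S v) (γ : Gate S v C.size) : Circuit S v where
  size := C.size + 1
  gate := Fin.snoc (α := fun k => Gate S v k) C.gate γ
  output := Fin.last _

theorem Circuit.polyAt_of_gate_var {v : ℕ} {C : Circuit S v} {k : Fin C.size} {i : Fin v}
    (h : C.gate k = .var i) : C.polyAt k = X i := by
  rw [Circuit.polyAt.eq_def, h]

theorem Circuit.polyAt_of_gate_const {v : ℕ} {C : Circuit S v} {k : Fin C.size} {c : S}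
    (h : C.gate k = .const c) : C.polyAt k = MvPolynomial.C c := by
  rw [Circuit.polyAt.eq_def, h]

theorem Circuit.polyAt_of_gate_sum {v : ℕ} {C : Circuit S v} {k : Fin C.size} {a b : Fin k}
    (h : C.gate k = .sum a b) :
    C.polyAt k = C.polyAt ⟨a, a.2.trans k.2⟩ + C.polyAt ⟨b, b.2.trans k.2⟩ := by
  rw [Circuit.polyAt.eq_def, h]

theorem Circuit.polyAt_of_gate_prod {v : ℕ} {C : Circuit S v} {k : Fin C.size} {a b : Fin k}
    (h : C.gate k = .prod a b) :
    C.polyAt k = C.polyAt ⟨a, a.2.trans k.2⟩ * C.polyAt ⟨b, b.2.trans k.2⟩ := by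
  rw [Circuit.polyAt.eq_def, h]

/-- If the gates of `C` are the first gates of `C'`, they compute the same polynomials in both. -/
theorem Circuit.polyAt_eq_of_gate_eq {v : ℕ} {C C' : Circuit S v} (hle : C.size ≤ C'.size)
    (h : ∀ (k : ℕ) (hk : k < C.size), C'.gate ⟨k, hk.trans_le hle⟩ = C.gate ⟨k, hk⟩)
    (k : ℕ) (hk : k < C.size) : C'.polyAt ⟨k, hk.trans_le hle⟩ = C.polyAt ⟨k, hk⟩ := by
  induction k using Nat.strong_induction_on with
  | _ k ih =>
    have hk' := h k hk
    rcases hC : C.gate ⟨k, hk⟩ with i | c | ⟨a, b⟩ | ⟨a, b⟩ <;> rw [hC] at hk'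
    · rw [polyAt_of_gate_var hC, polyAt_of_gate_var hk']
    · rw [polyAt_of_gate_const hC, polyAt_of_gate_const hk']
    · rw [polyAt_of_gate_sum hC, polyAt_of_gate_sum hk', ih a a.2, ih b b.2]
    · rw [polyAt_of_gate_prod hC, polyAt_of_gate_prod hk', ih a a.2, ih b b.2]

omit [CommSemiring S] in
theorem Circuit.gate_snoc {v : ℕ} (C : Circuit S v) (γ : Gate S v C.size) (k : ℕ)
    (hk : k < C.size) : (C.snoc γ).gate ⟨k, hk.trans_le (Nat.le_succ _)⟩ = C.gate ⟨k, hk⟩ :=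
  Fin.snoc_castSucc (α := fun k => Gate S v k) γ C.gate ⟨k, hk⟩

omit [CommSemiring S] in
theorem Circuit.gate_output_snoc {v : ℕ} (C : Circuit S v) (γ : Gate S v C.size) :
    (C.snoc γ).gate (C.snoc γ).output = γ :=
  Fin.snoc_last (α := fun k => Gate S v k) γ C.gate

theorem Circuit.polyAt_snoc {v : ℕ} (C : Circuit S v) (γ : Gate S v C.size) (k : ℕ)
    (hk : k < C.size) :
    (C.snoc γ).polyAt ⟨k, hk.trans_le (Nat.le_succ _)⟩ = C.polyAt ⟨k, hk⟩ :=
  polyAt_eq_of_gate_eq (Nat.le_succ _) (C.gate_snoc γ) k hk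

theorem Circuit.range_polyAt_snoc {v : ℕ} (C : Circuit S v) (γ : Gate S v C.size) :
    Set.range C.polyAt ⊆ Set.range (C.snoc γ).polyAt := by
  rintro _ ⟨k, rfl⟩
  exact ⟨⟨k, k.2.trans_le (Nat.le_succ _)⟩, C.polyAt_snoc γ k k.2⟩

/-- `C'` extends `C` by `n` gates, and computes `p` at some gate. -/
def Circuit.Extends {v : ℕ} (C C' : Circuit S v) (n : ℕ) (p : MvPolynomial (Fin v) S) : Prop :=
  C'.size = C.size + n ∧ Set.range C.polyAt ⊆ Set.range C'.polyAt ∧ p ∈ Set.range C'.polyAt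

theorem Circuit.exists_extends_label {v : ℕ} (C : Circuit S v) (ℓ : Label S v) :
    ∃ C', C.Extends C' 1 ℓ.poly := by
  cases ℓ with
  | var i =>
    refine ⟨C.snoc (.var i), rfl, C.range_polyAt_snoc _, (C.snoc _).output, ?_⟩
    rw [polyAt_of_gate_var (C.gate_output_snoc _), Label.poly]
  | const c =>
    refine ⟨C.snoc (.const c), rfl, C.range_polyAt_snoc _, (C.snoc _).output, ?_⟩
    rw [polyAt_of_gate_const (C.gate_output_snoc _), Label.poly]

theorem Circuit.exists_extends_add {v : ℕ} (C : Circuit S v) {p q : MvPolynomial (Fin v) S}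
    (hp : p ∈ Set.range C.polyAt) (hq : q ∈ Set.range C.polyAt) :
    ∃ C', C.Extends C' 1 (p + q) := by
  obtain ⟨a, rfl⟩ := hp
  obtain ⟨b, rfl⟩ := hq
  refine ⟨C.snoc (.sum a b), rfl, C.range_polyAt_snoc _, (C.snoc _).output, ?_⟩
  rw [polyAt_of_gate_sum (C.gate_output_snoc _)]
  exact congrArg₂ _ (C.polyAt_snoc _ a a.2) (C.polyAt_snoc _ b b.2)

theorem Circuit.exists_extends_mul {v : ℕ} (C : Circuit S v) {p q : MvPolynomial (Fin v) S}
    (hp : p ∈ Set.range C.polyAt) (hq : q ∈ Set.range C.polyAt) :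
    ∃ C', C.Extends C' 1 (p * q) := by
  obtain ⟨a, rfl⟩ := hp
  obtain ⟨b, rfl⟩ := hq
  refine ⟨C.snoc (.prod a b), rfl, C.range_polyAt_snoc _, (C.snoc _).output, ?_⟩
  rw [polyAt_of_gate_prod (C.gate_output_snoc _)]
  exact congrArg₂ _ (C.polyAt_snoc _ a a.2) (C.polyAt_snoc _ b b.2)

theorem Circuit.exists_extends_mul_label {v : ℕ} (C : Circuit S v) {p : MvPolynomial (Fin v) S}
    (hp : p ∈ Set.range C.polyAt) (ℓ : Label S v) :
    ∃ C', C.Extends C' 2 (p * ℓ.poly) := by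
  obtain ⟨C₁, h₁, h₁', h₁''⟩ := C.exists_extends_label ℓ
  obtain ⟨C₂, h₂, h₂', h₂''⟩ := C₁.exists_extends_mul (h₁' hp) h₁''
  exact ⟨C₂, by rw [h₂, h₁], h₁'.trans h₂', h₂''⟩

theorem Circuit.exists_extends_vecMul {v : ℕ} (C : Circuit S v)
    {u : Fin 2 → MvPolynomial (Fin v) S} (hu : ∀ i, u i ∈ Set.range C.polyAt)
    (M : Fin 2 → Fin 2 → Label S v) (j : Fin 2) :
    ∃ C', C.Extends C' 5 (Matrix.vecMul u (layerMatrix M) j) := by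
  obtain ⟨C₁, h₁, h₁', h₁''⟩ := C.exists_extends_mul_label (hu 0) (M 0 j)
  obtain ⟨C₂, h₂, h₂', h₂''⟩ := C₁.exists_extends_mul_label (h₁' (hu 1)) (M 1 j)
  obtain ⟨C₃, h₃, h₃', h₃''⟩ := C₂.exists_extends_add (h₂' h₁'') h₂''
  refine ⟨C₃, by rw [h₃, h₂, h₁], (h₁'.trans h₂').trans h₃', ?_⟩
  simpa [Matrix.vecMul, dotProduct, layerMatrix] using h₃''

open Matrix in
theorem Circuit.exists_extends_foldl {v : ℕ} (l : List (Fin 2 → Fin 2 → Label S v)) :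
    ∀ (C : Circuit S v) {u : Fin 2 → MvPolynomial (Fin v) S},
      (∀ i, u i ∈ Set.range C.polyAt) → ∀ j, ∃ C',
        C.Extends C' (10 * l.length) ((l.map layerMatrix).foldl (fun u M => u ᵥ* M) u j) := by
  induction l with
  | nil => exact fun C u hu j => ⟨C, rfl, subset_rfl, hu j⟩
  | cons M l ih =>
    intro C u hu j
    obtain ⟨C₁, h₁, h₁', h₁''⟩ := C.exists_extends_vecMul hu M 0
    obtain ⟨C₂, h₂, h₂', h₂''⟩ := C₁.exists_extends_vecMul (fun i => h₁' (hu i)) M 1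
    obtain ⟨C₃, h₃, h₃', h₃''⟩ := ih C₂ (u := u ᵥ* layerMatrix M)
      (Fin.forall_fin_two.mpr ⟨h₂' h₁'', h₂''⟩) j
    exact ⟨C₃, by rw [h₃, h₂, h₁, List.length_cons]; ring, (h₁'.trans h₂').trans h₃', h₃''⟩

theorem ABP.exists_circuit {v : ℕ} (A : ABP S 2 v) :
    ∃ C : Circuit S v, C.size = 10 * A.length + 2 ∧ C.poly = A.poly := by
  let C₀ : Circuit S v := ⟨1, fun _ => .const 0, 0⟩
  have h₀ : (0 : MvPolynomial (Fin v) S) ∈ Set.range C₀.polyAt :=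
    ⟨0, (Circuit.polyAt_of_gate_const rfl).trans C_0⟩
  obtain ⟨C₁, h₁, h₁', h₁''⟩ := C₀.exists_extends_label (.const 1)
  have hu (i : Fin 2) : (Pi.single A.source 1 : Fin 2 → MvPolynomial (Fin v) S) i ∈
      Set.range C₁.polyAt := by
    rw [Pi.single_apply]
    split_ifs
    · exact h₁''
    · exact h₁' h₀
  obtain ⟨C₂, h₂, -, k, hk⟩ := C₁.exists_extends_foldl (List.ofFn A.label) hu A.sink
  refine ⟨⟨C₂.size, C₂.gate, k⟩, ?_, ?_⟩
  · simp only [h₂, h₁, List.length_ofFn, C₀]; ring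
  · rw [A.poly_eq, ← hk]
    exact Circuit.polyAt_eq_of_gate_eq (C := C₂) (C' := ⟨C₂.size, C₂.gate, k⟩) le_rfl
      (fun _ _ => rfl) k k.2

theorem VBP_two_subset_VP : VBP S 2 ⊆ VP S := by
  rintro f ⟨hf, A, ⟨P, hP⟩, hA⟩
  choose C hC hC' using fun n => (A n).exists_circuit
  refine ⟨hf, C, ⟨5 * P + 2, fun n => ?_⟩, fun n => hC' n ▸ hA n⟩
  have := hP n
  simp only [ABP.size] at this
  simp only [hC, Polynomial.eval_add, Polynomial.eval_mul, Polynomial.eval_ofNat]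
  lia

theorem hypercubeSums_mono {K K' : Set (PolyFamily S)} (h : K ⊆ K') :
    hypercubeSums K ⊆ hypercubeSums K' := by
  rintro f ⟨hf, g, hg, H⟩
  exact ⟨hf, g, h hg, H⟩

/-! ### Branching programs of width two for formulas in conjunctive normal form -/

/-- The branching program with the given layers of edges. -/
def ABP.ofList {w v : ℕ} (l : List (Fin w → Fin w → Label S v)) (s t : Fin w) : ABP S w v :=
  ⟨l.length, l.get, s, t⟩

open Matrix in
/-- The action of a list of layers on row vectors, at a point `z`. -/
noncomputable def runLayers {w v : ℕ} (z : Fin v → S) (l : List (Fin w → Fin w → Label S v))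
    (u : Fin w → S) : Fin w → S :=
  l.foldl (fun u M => u ᵥ* (layerMatrix M).map (eval z)) u

theorem runLayers_append {w v : ℕ} (z : Fin v → S) (l l' : List (Fin w → Fin w → Label S v))
    (u : Fin w → S) : runLayers z (l ++ l') u = runLayers z l' (runLayers z l u) :=
  List.foldl_append

open Matrix in
theorem eval_foldl_layerMatrix {w v : ℕ} (z : Fin v → S)
    (l : List (Fin w → Fin w → Label S v)) (u : Fin w → MvPolynomial (Fin v) S) (j : Fin w) :
    eval z ((l.map layerMatrix).foldl (fun u M => u ᵥ* M) u j) =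
      runLayers z l (fun i => eval z (u i)) j := by
  induction l generalizing u with
  | nil => rfl
  | cons M l ih =>
    rw [List.map_cons, List.foldl_cons, ih, runLayers, runLayers, List.foldl_cons]
    exact congrArg (fun u' => l.foldl (fun u M => u ᵥ* (layerMatrix M).map (eval z)) u' j)
      (funext fun i => RingHom.map_vecMul (eval z) _ _ i)

theorem ABP.eval_poly_ofList {w v : ℕ} (z : Fin v → S) (l : List (Fin w → Fin w → Label S v))
    (s t : Fin w) : eval z (ABP.ofList l s t).poly = runLayers z l (Pi.single s 1) t := by
  have h : (fun i => eval z ((Pi.single s 1 : Fin w → MvPolynomial (Fin v) S) i)) =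
      Pi.single s 1 := by
    funext i
    rw [Pi.single_apply, Pi.single_apply]
    split_ifs <;> simp
  rw [ABP.poly_eq, eval_foldl_layerMatrix, ABP.ofList, h, List.ofFn_get]

/-- Layers of width two that multiply by a sum of labels. -/
def sumLayers {v : ℕ} (c : List (Label S v)) : List (Fin 2 → Fin 2 → Label S v) :=
  c.map (fun ℓ => ![![.const 1, ℓ], ![.const 0, .const 1]]) ++
    [![![.const 0, .const 0], ![.const 1, .const 0]]]

/-- Layers of width two that multiply by `y' + y * ℓ`. -/
def selectLayers {v : ℕ} (y y' ℓ : Label S v) : List (Fin 2 → Fin 2 → Label S v) :=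
  [![![y', y], ![.const 0, .const 0]], ![![.const 1, .const 0], ![ℓ, .const 0]]]

theorem runLayers_selectLayers {v : ℕ} (z : Fin v → S) (y y' ℓ : Label S v) (P : S) :
    runLayers z (selectLayers y y' ℓ) ![P, 0] =
      ![P * (eval z y'.poly + eval z y.poly * eval z ℓ.poly), 0] := by
  ext j
  fin_cases j <;>
    simp [runLayers, selectLayers, -Matrix.vecMul_vecMul, Matrix.vecMul, dotProduct, layerMatrix,
      Label.poly, mul_add, mul_assoc]

theorem runLayers_sumLayers {v : ℕ} (z : Fin v → S) (c : List (Label S v)) (P : S) :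
    runLayers z (sumLayers c) ![P, 0] = ![P * (c.map fun ℓ => eval z ℓ.poly).sum, 0] := by
  -- The first entry is kept while the second one accumulates the sum; the last layer moves the
  -- sum to the first entry.
  have h (Q : S) : runLayers z (c.map fun ℓ => ![![.const 1, ℓ], ![.const 0, .const 1]]) ![P, Q] =
      ![P, Q + P * (c.map fun ℓ => eval z ℓ.poly).sum] := by
    induction c generalizing Q with
    | nil => simp [runLayers]
    | cons ℓ c ih =>
      rw [List.map_cons, ← List.singleton_append, runLayers_append]
      have h' : runLayers z [![![.const 1, ℓ], ![.const 0, .const 1]]] ![P, Q] =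
          ![P, Q + P * eval z ℓ.poly] := by
        ext j
        fin_cases j <;>
          simp [runLayers, Matrix.vecMul, dotProduct, layerMatrix, Label.poly, add_comm]
      rw [h', ih, List.map_cons, List.sum_cons, mul_add, add_assoc]
  rw [sumLayers, runLayers_append, h, zero_add]
  ext j
  fin_cases j <;> simp [runLayers, Matrix.vecMul, dotProduct, layerMatrix, Label.poly]

theorem runLayers_flatMap {v : ℕ} {ι : Type*} (z : Fin v → S) (l : List ι)
    (f : ι → List (Fin 2 → Fin 2 → Label S v)) (g : ι → S)
    (h : ∀ i P, runLayers z (f i) ![P, 0] = ![P * g i, 0]) (P : S) :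
    runLayers z (l.flatMap f) ![P, 0] = ![P * (l.map g).prod, 0] := by
  induction l generalizing P with
  | nil => simp [runLayers]
  | cons i l ih =>
    rw [List.flatMap_cons, runLayers_append, h, ih, List.map_cons, List.prod_cons, mul_assoc]

/-- The truth value of a formula in conjunctive normal form, given by its list of clauses; the
literal `(j, true)` is the variable `j`, and `(j, false)` its negation. -/
def cnfEval {β : Type} (φ : List (List (β × Bool))) (a : β → Bool) : Bool :=
  φ.all fun c => c.any fun l => a l.1 == l.2

end

section
variable {S : Type} [CommSemiring S] [LinearOrder S] [MinSemiring S]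
open MinSemiring

theorem sum_map_bit {ι : Type*} (l : List ι) (f : ι → Bool) :
    (l.map fun i => (bit (f i) : S)).sum = bit (l.any f) := by
  induction l with
  | nil => rfl
  | cons i l ih => rw [List.map_cons, List.sum_cons, ih, bit_add_bit, List.any_cons]

omit [LinearOrder S] [MinSemiring S] in
theorem prod_map_bit {ι : Type*} (l : List ι) (f : ι → Bool) :
    (l.map fun i => (bit (f i) : S)).prod = bit (l.all f) := by
  induction l with
  | nil => rfl
  | cons i l ih => rw [List.map_cons, List.prod_cons, ih, bit_mul_bit, List.all_cons]

/-- A branching program of width two can check a formula in conjunctive normal form and, for every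
variable of the formula which is true, pay a given label. -/
theorem exists_abp_cnf {v : ℕ} {β : Type} [Fintype β] (φ : List (List (β × Bool)))
    (y y' : β → Fin v) (ℓ : β → Label S v) :
    ∃ A : ABP S 2 v, A.length = (φ.map fun c => c.length + 1).sum + 2 * Fintype.card β ∧
      ∀ (z : Fin v → S) (a : β → Bool), (∀ j, z (y j) = bit (a j)) →
        (∀ j, z (y' j) = bit (!a j)) →
        eval z A.poly = bit (cnfEval φ a) * ∏ j, if a j then eval z (ℓ j).poly else 1 := by
  let lit : β × Bool → Label S v := fun l => .var (if l.2 then y l.1 else y' l.1)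
  refine ⟨ABP.ofList (φ.flatMap (fun c => sumLayers (c.map lit)) ++
    Finset.univ.toList.flatMap fun j => selectLayers (.var (y j)) (.var (y' j)) (ℓ j)) 0 0, ?_, ?_⟩
  · simp [ABP.ofList, List.length_flatMap, sumLayers, selectLayers, mul_comm]
  · intro z a hy hy'
    have hlit (l : β × Bool) : eval z (lit l).poly = bit (a l.1 == l.2) := by
      rcases l with ⟨j, _ | _⟩ <;> simp [lit, Label.poly, hy, hy']
    have h1 : (Pi.single 0 1 : Fin 2 → S) = ![1, 0] := by
      ext j; fin_cases j <;> simp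
    rw [ABP.eval_poly_ofList, h1, runLayers_append,
      runLayers_flatMap z φ _ (fun c => bit (c.any fun l => a l.1 == l.2)),
      runLayers_flatMap z _ _ fun j => if a j then eval z (ℓ j).poly else 1]
    · rw [prod_map_bit, one_mul, Finset.prod_map_toList]; rfl
    · intro j P
      rw [runLayers_selectLayers]
      cases h : a j <;> simp [Label.poly, hy, hy', h, bit]
    · intro c P
      rw [runLayers_sumLayers, List.map_map, ← sum_map_bit]
      simp only [Function.comp_def, hlit]
end

/-! ### Constraint satisfaction in conjunctive normal form -/

/-- Choices `s i` of a value for every position `i`, subject to binary constraints `T`, are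
described by a formula in conjunctive normal form in the variables `s i = x`. -/
theorem exists_cnf_of_constraints {I A : Type} [Fintype I] [Fintype A] [DecidableEq I]
    [DecidableEq A] (T : I × A → I × A → Prop) :
    ∃ φ : List (List ((I × A) × Bool)),
      (φ.map fun c => c.length + 1).sum ≤
        Fintype.card I * (Fintype.card A + 1) + Fintype.card (I × A) ^ 2 * 3 ∧
      ∀ a : I × A → Bool, cnfEval φ a = true ↔
        ∃ s : I → A, (∀ i x, a (i, x) = decide (x = s i)) ∧ ∀ i j, T (i, s i) (j, s j) := by
  classical
  -- `F` consists of the pairs that must not be true simultaneously: those which violate `T`, and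
  -- those which assign two values to the same position.
  let F : Finset ((I × A) × (I × A)) :=
    Finset.univ.filter fun p => ¬ T p.1 p.2 ∨ (p.1.1 = p.2.1 ∧ p.1.2 ≠ p.2.2)
  refine ⟨Finset.univ.toList.map (fun i => Finset.univ.toList.map fun x => ((i, x), true)) ++
    F.toList.map fun p => [(p.1, false), (p.2, false)], ?_, fun a => ?_⟩
  · have hF : F.card ≤ Fintype.card (I × A) ^ 2 := by
      rw [sq, ← Fintype.card_prod]; exact Finset.card_le_univ F
    simp only [List.map_append, List.map_map, Function.comp_def, List.length_map,
      Finset.length_toList, List.length_cons, List.length_nil, List.map_const', List.sum_append,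
      List.sum_replicate, Finset.card_univ, smul_eq_mul]
    gcongr
  · have h1 : cnfEval (Finset.univ.toList.map (fun i => Finset.univ.toList.map fun x =>
        ((i, x), true)) ++ F.toList.map fun p => [(p.1, false), (p.2, false)]) a = true ↔
        (∀ i, ∃ x, a (i, x) = true) ∧ ∀ p ∈ F, a p.1 = false ∨ a p.2 = false := by
      simp [cnfEval, List.all_append, List.all_eq_true]
    rw [h1]
    constructor
    · rintro ⟨h, h'⟩
      choose s hs using h
      have hF (p : (I × A) × (I × A)) (h1 : a p.1 = true) (h2 : a p.2 = true) : p ∉ F := by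
        intro hp
        rcases h' p hp with h | h <;> simp_all
      refine ⟨s, fun i x => ?_, fun i j => ?_⟩
      · by_cases hx : x = s i
        · simp [hx, hs]
        · by_contra h
          have h0 : a (i, x) = true := by simpa [hx] using h
          exact hF ((i, x), (i, s i)) h0 (hs i) (by simp [F, hx])
      · by_contra h
        exact hF ((i, s i), (j, s j)) (hs i) (hs j) (by simp [F, h])
    · rintro ⟨s, hs, hT⟩
      refine ⟨fun i => ⟨s i, by simp [hs]⟩, ?_⟩
      rintro ⟨⟨i, x⟩, ⟨j, y⟩⟩ hp
      simp only [F, Finset.mem_filter, Finset.mem_univ, true_and] at hp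
      simp only [hs, decide_eq_false_iff_not]
      by_contra! h
      obtain ⟨rfl, rfl⟩ := h
      rcases hp with hp | ⟨rfl, hp⟩
      · exact hp (hT i j)
      · exact hp rfl

/-! ### Weighted grammars -/

/-- A weighted context-free grammar in Chomsky normal form, with nonterminals `N` and rules `P`. A
rule rewrites its source into a terminal, which is a label, or into two nonterminals. -/
structure Grammar (S : Type) (v : ℕ) (N P : Type) where
  src : P → N
  body : P → Label S v ⊕ N × N

namespace Grammar

section
variable {S : Type} [CommSemiring S] {v : ℕ} {N P : Type} (G : Grammar S v N P)

/-- The label to be paid when a rule is applied. -/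
def label (r : P) : Label S v := Sum.elim id (fun _ => .const 1) (G.body r)

/-- `G.Derives z A u m`: at the point `z`, there is a parse tree of weight `u` with `m` inner nodes
and root `A`. -/
inductive Derives (z : Fin v → S) : N → S → ℕ → Prop
  | leaf {r : P} {ℓ : Label S v} (h : G.body r = .inl ℓ) : Derives z (G.src r) (eval z ℓ.poly) 0
  | branch {r : P} {A B : N} {u u' : S} {m m' : ℕ} (h : G.body r = .inr (A, B))
      (h₁ : Derives z A u m) (h₂ : Derives z B u' m') :
      Derives z (G.src r) (u * u') (m + m' + 1)

/-- Parse trees are encoded by words, which list the nodes in preorder. The symbol of a node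
consists of its rule, the size of the subtree at this node and the size of the subtree at its first
child. This is the condition on the symbol at position `i`. -/
def LocalAt (σ : ℕ → P × ℕ × ℕ) (i : ℕ) : Prop :=
  match G.body (σ i).1 with
  | .inl _ => (σ i).2.1 = 1 ∧ (σ i).2.2 = 0
  | .inr (A, B) => 1 ≤ (σ i).2.2 ∧ 1 + (σ i).2.2 < (σ i).2.1 ∧
      G.src (σ (i + 1)).1 = A ∧ (σ (i + 1)).2.1 = (σ i).2.2 ∧
      G.src (σ (i + 1 + (σ i).2.2)).1 = B ∧
      (σ i).2.1 = 1 + (σ i).2.2 + (σ (i + 1 + (σ i).2.2)).2.1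

omit [CommSemiring S] in
/-- The condition on a symbol only refers to positions inside the subtree of its node, so it is
preserved when a word is embedded into another one. -/
theorem localAt_add {G : Grammar S v N P} {σ τ : ℕ → P × ℕ × ℕ} {c n i : ℕ}
    (h : ∀ j < n, τ (c + j) = σ j) (hi : i + (σ i).2.1 ≤ n) (hσ : G.LocalAt σ i) :
    G.LocalAt τ (c + i) ∧ (τ (c + i)).2.1 = (σ i).2.1 := by
  have h0 : 1 ≤ (σ i).2.1 := by
    unfold LocalAt at hσ
    split at hσ <;> lia
  have h1 : τ (c + i) = σ i := h i (by lia)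
  refine ⟨?_, by rw [h1]⟩
  unfold LocalAt at hσ ⊢
  rw [h1]
  split at hσ
  · exact hσ
  · rw [add_assoc c i 1, add_assoc c (i + 1), h _ (by lia), h _ (by lia)]
    exact hσ

/-- Completeness of the encoding of parse trees by words. -/
theorem Derives.exists_word {z : Fin v → S} {G : Grammar S v N P} {A : N} {u : S} {m : ℕ}
    (h : G.Derives z A u m) :
    ∃ σ : ℕ → P × ℕ × ℕ, G.src (σ 0).1 = A ∧ (σ 0).2.1 = 2 * m + 1 ∧
      (∀ i < 2 * m + 1, G.LocalAt σ i ∧ i + (σ i).2.1 ≤ 2 * m + 1) ∧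
      ∏ i ∈ Finset.range (2 * m + 1), eval z (G.label (σ i).1).poly = u := by
  induction h with
  | @leaf r ℓ h =>
    refine ⟨fun _ => (r, 1, 0), rfl, rfl, fun i hi => ⟨?_, ?_⟩, ?_⟩
    · simp [LocalAt, h]
    · dsimp only; lia
    · simp [label, h]
  | @branch r A B u u' m m' h _ _ ih₁ ih₂ =>
    obtain ⟨σ₁, hA, hn₁, hσ₁, hu₁⟩ := ih₁
    obtain ⟨σ₂, hB, hn₂, hσ₂, hu₂⟩ := ih₂
    let τ : ℕ → P × ℕ × ℕ := fun k => if k = 0 then (r, 2 * (m + m' + 1) + 1, 2 * m + 1) else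
      if k ≤ 2 * m + 1 then σ₁ (k - 1) else σ₂ (k - (2 * m + 2))
    have h0 : τ 0 = (r, 2 * (m + m' + 1) + 1, 2 * m + 1) := rfl
    have h1 : ∀ j < 2 * m + 1, τ (1 + j) = σ₁ j := fun j hj => by
      simp only [τ]
      rw [if_neg (by lia), if_pos (by lia), Nat.add_sub_cancel_left]
    have h2 : ∀ j < 2 * m' + 1, τ (2 * m + 2 + j) = σ₂ j := fun j hj => by
      simp only [τ]
      rw [if_neg (by lia), if_neg (by lia), Nat.add_sub_cancel_left]
    have h1' : τ (0 + 1) = σ₁ 0 := h1 0 (by lia)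
    have h2' : τ (0 + 1 + (2 * m + 1)) = σ₂ 0 := by
      rw [← h2 0 (by lia)]; congr 1; ring
    refine ⟨τ, by rw [h0], by rw [h0], fun i hi => ?_, ?_⟩
    · rcases Nat.eq_zero_or_pos i with rfl | hi0
      · refine ⟨?_, by rw [h0]; lia⟩
        unfold LocalAt
        rw [h0, h]
        dsimp only
        rw [h1', h2']
        exact ⟨by lia, by lia, hA, hn₁, hB, by rw [hn₂]; ring⟩
      · rcases Nat.lt_or_ge i (2 * m + 2) with hi1 | hi1
        · obtain ⟨j, rfl⟩ := Nat.exists_eq_add_of_le (Nat.succ_le_of_lt hi0)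
          obtain ⟨h3, h4⟩ := hσ₁ j (by lia)
          obtain ⟨h5, h6⟩ := localAt_add h1 h4 h3
          exact ⟨h5, by simp only [Nat.succ_eq_add_one, zero_add] at *; lia⟩
        · obtain ⟨j, rfl⟩ := Nat.exists_eq_add_of_le hi1
          obtain ⟨h3, h4⟩ := hσ₂ j (by lia)
          obtain ⟨h5, h6⟩ := localAt_add h2 h4 h3
          exact ⟨h5, by lia⟩
    · rw [show 2 * (m + m' + 1) + 1 = 2 * m + 2 + (2 * m' + 1) by ring, Finset.prod_range_add,
        show 2 * m + 2 = 2 * m + 1 + 1 by ring, Finset.prod_range_succ', h0, ← hu₁, ← hu₂]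
      have h3 : eval z (G.label r).poly = 1 := by simp [label, h, Label.poly]
      rw [h3, mul_one]
      congr 1
      · refine Finset.prod_congr rfl fun j hj => ?_
        rw [add_comm j 1, h1 j (Finset.mem_range.mp hj)]
      · refine Finset.prod_congr rfl fun j hj => ?_
        rw [h2 j (Finset.mem_range.mp hj)]

end

section
variable {S : Type} [CommSemiring S] [LinearOrder S] [MinSemiring S] {v : ℕ} {N P : Type}
  (G : Grammar S v N P)

/-- `val` is a lower bound for the weights of parse trees, rule by rule. -/
def IsLowerBound (z : Fin v → S) (val : N → S) : Prop :=
  ∀ r : P, match G.body r with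
    | .inl ℓ => val (G.src r) ≤ eval z ℓ.poly
    | .inr (A, B) => val (G.src r) ≤ val A * val B

/-- Soundness of the encoding of parse trees by words: the symbols from position `i` on encode a
parse tree, whose weight is bounded below by the value of its root. -/
theorem IsLowerBound.le_prod {G : Grammar S v N P} {z : Fin v → S} {val : N → S}
    (hval : G.IsLowerBound z val) {σ : ℕ → P × ℕ × ℕ} {L : ℕ}
    (hσ : ∀ i < L, G.LocalAt σ i ∧ i + (σ i).2.1 ≤ L) (n i : ℕ) (hi : i < L)
    (hn : (σ i).2.1 = n) :
    val (G.src (σ i).1) ≤ ∏ j ∈ Finset.Ico i (i + n), eval z (G.label (σ j).1).poly := by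
  induction n using Nat.strong_induction_on generalizing i with
  | _ n ih =>
    obtain ⟨h, hL⟩ := hσ i hi
    have hv := hval (σ i).1
    unfold LocalAt at h
    split at h
    case h_1 ℓ hb =>
      rw [hb] at hv
      rw [← hn, h.1]
      simpa [label, hb] using hv
    case h_2 A B hb =>
      rw [hb] at hv
      obtain ⟨h1, h2, h3, h4, h5, h6⟩ := h
      have h7 : eval z (G.label (σ i).1).poly = 1 := by simp [label, hb, Label.poly]
      rw [Finset.prod_eq_prod_Ico_succ_bot (by lia), h7, one_mul,
        ← Finset.prod_Ico_consecutive _ (n := i + 1 + (σ i).2.2) (by lia) (by lia)]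
      refine hv.trans (MinSemiring.mul_le_mul_of_le ?_ ?_)
      · rw [← h3]
        exact ih _ (by lia) _ (by lia) h4
      · rw [← h5, show i + n = i + 1 + (σ i).2.2 + (σ (i + 1 + (σ i).2.2)).2.1 by lia]
        exact ih _ (by lia) _ (by lia) rfl

/-- The condition on the symbols `p.2` at position `p.1` and `p'.2` at position `p'.1` in the word
of a parse tree of size `L` with root `A₀`. -/
def Compat (A₀ : N) (L : ℕ) (p p' : Fin L × (P × Fin (L + 1) × Fin (L + 1))) : Prop :=
  (p.1 : ℕ) + p.2.2.1 ≤ L ∧ ((p.1 : ℕ) = 0 → G.src p.2.1 = A₀ ∧ (p.2.2.1 : ℕ) = L) ∧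
  match G.body p.2.1 with
  | .inl _ => (p.2.2.1 : ℕ) = 1 ∧ (p.2.2.2 : ℕ) = 0
  | .inr (A, B) => 1 ≤ (p.2.2.2 : ℕ) ∧ 1 + (p.2.2.2 : ℕ) < p.2.2.1 ∧
      ((p'.1 : ℕ) = p.1 + 1 → G.src p'.2.1 = A ∧ (p'.2.2.1 : ℕ) = p.2.2.2) ∧
      ((p'.1 : ℕ) = p.1 + 1 + p.2.2.2 →
        G.src p'.2.1 = B ∧ (p.2.2.1 : ℕ) = 1 + p.2.2.2 + p'.2.2.1)

omit [CommSemiring S] [LinearOrder S] [MinSemiring S] in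
theorem forall_compat_iff {A₀ : N} {L : ℕ} {s : Fin L → P × Fin (L + 1) × Fin (L + 1)}
    {σ : ℕ → P × ℕ × ℕ} (h : ∀ i : Fin L, σ i = ((s i).1, ((s i).2.1 : ℕ), ((s i).2.2 : ℕ)))
    (hL : 0 < L) :
    (∀ i j, G.Compat A₀ L (i, s i) (j, s j)) ↔
      (∀ i < L, G.LocalAt σ i ∧ i + (σ i).2.1 ≤ L) ∧ G.src (σ 0).1 = A₀ ∧ (σ 0).2.1 = L := by
  constructor
  · intro H
    refine ⟨fun i hi => ?_, ?_⟩
    · have hi' := h ⟨i, hi⟩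
      simp only at hi'
      have H1 := (H ⟨i, hi⟩ ⟨i, hi⟩).1
      refine ⟨?_, by rw [hi']; exact H1⟩
      unfold LocalAt
      rw [hi']
      split
      case h_1 ℓ hb =>
        have H2 := (H ⟨i, hi⟩ ⟨i, hi⟩).2.2
        rw [hb] at H2
        exact H2
      case h_2 A B hb =>
        have H2 (j) := (H ⟨i, hi⟩ j).2.2
        simp only [hb] at H2 H1
        obtain ⟨H3, H4, -⟩ := H2 ⟨i, hi⟩
        have H5 := (H2 ⟨i + 1, by lia⟩).2.2.1 rfl
        have H6 := (H2 ⟨i + 1 + (s ⟨i, hi⟩).2.2, by lia⟩).2.2.2 rfl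
        have h5 := h ⟨i + 1, by lia⟩
        have h6 := h ⟨i + 1 + (s ⟨i, hi⟩).2.2, by lia⟩
        simp only at h5 h6
        dsimp only
        rw [h5, h6]
        exact ⟨H3, H4, H5.1, H5.2, H6.1, H6.2⟩
    · have h0 := h ⟨0, hL⟩
      simp only at h0
      rw [h0]
      exact (H ⟨0, hL⟩ ⟨0, hL⟩).2.1 rfl
  · rintro ⟨H, H'⟩ i j
    obtain ⟨H1, H2⟩ := H i i.2
    rw [h i] at H2
    refine ⟨H2, fun hi => ?_, ?_⟩
    · dsimp only at hi
      have h0 := h i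
      rw [hi] at h0
      rw [h0] at H'
      exact H'
    · unfold LocalAt at H1
      rw [h i] at H1
      dsimp only at H1 ⊢
      split at H1
      case h_1 ℓ hb => simpa only [hb] using H1
      case h_2 A B hb =>
        refine ⟨H1.1, H1.2.1, fun hj => ?_, fun hj => ?_⟩
        · rw [← hj, h j] at H1
          exact ⟨H1.2.2.1, H1.2.2.2.1⟩
        · rw [← hj, h j] at H1
          exact H1.2.2.2.2

/-- The minimal weight of parse trees with `m` inner nodes is the minimal weight of an assignment
satisfying a formula in conjunctive normal form. -/
theorem exists_cnf [Fintype P] (A₀ : N) {m L : ℕ} (hL : L = 2 * m + 1) :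
    ∃ φ : List (List ((Fin L × (P × Fin (L + 1) × Fin (L + 1))) × Bool)),
      (φ.map fun c => c.length + 1).sum ≤ L * (Fintype.card P * (L + 1) ^ 2 + 1) +
        (L * (Fintype.card P * (L + 1) ^ 2)) ^ 2 * 3 ∧
      ∀ z : Fin v → S,
        (∀ val : N → S, G.IsLowerBound z val → ∀ a, val A₀ ≤ bit (cnfEval φ a) *
          ∏ j, if a j then eval z (G.label j.2.1).poly else 1) ∧
        ∀ u : S, G.Derives z A₀ u m → ∃ a, bit (cnfEval φ a) *
          (∏ j, if a j then eval z (G.label j.2.1).poly else 1) = u := by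
  classical
  obtain ⟨φ, hφ, H⟩ := exists_cnf_of_constraints (G.Compat A₀ L)
  refine ⟨φ, hφ.trans_eq ?_, fun z => ?_⟩
  · simp only [Fintype.card_prod, Fintype.card_fin]; ring
  have hprod (s : Fin L → P × Fin (L + 1) × Fin (L + 1))
      (a : Fin L × (P × Fin (L + 1) × Fin (L + 1)) → Bool)
      (ha : ∀ i x, a (i, x) = decide (x = s i)) :
      (∏ j, if a j then eval z (G.label j.2.1).poly else 1) =
        ∏ i, eval z (G.label (s i).1).poly := by
    rw [Fintype.prod_prod_type]
    refine Finset.prod_congr rfl fun i _ => ?_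
    rw [Finset.prod_eq_single (s i) (fun x _ hx => by simp [ha, hx]) (by simp)]
    simp [ha]
  constructor
  · intro val hval a
    cases ha : cnfEval φ a with
    | false => simpa [bit] using MinSemiring.le_zero _
    | true =>
      obtain ⟨s, hs, hs'⟩ := (H a).mp ha
      have hL0 : 0 < L := by lia
      -- The values of `σ` beyond `L` do not matter.
      let σ : ℕ → P × ℕ × ℕ := fun i =>
        ((s ⟨i % L, Nat.mod_lt _ hL0⟩).1, ((s ⟨i % L, Nat.mod_lt _ hL0⟩).2.1 : ℕ),
          ((s ⟨i % L, Nat.mod_lt _ hL0⟩).2.2 : ℕ))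
      have hσ (i : Fin L) : σ i = ((s i).1, ((s i).2.1 : ℕ), ((s i).2.2 : ℕ)) := by
        simp only [σ, Nat.mod_eq_of_lt i.2]
      obtain ⟨h1, h2, h3⟩ := (G.forall_compat_iff hσ hL0).mp hs'
      have h4 := hval.le_prod h1 L 0 hL0 h3
      rw [h2, zero_add, ← Finset.range_eq_Ico, ← Fin.prod_univ_eq_prod_range
        (fun j => eval z (G.label (σ j).1).poly) L] at h4
      simp only [hσ] at h4
      simpa [bit, hprod s a hs] using h4
  · intro u hu
    subst hL
    obtain ⟨σ, h1, h2, h3, h4⟩ := hu.exists_word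
    have hle (i : ℕ) (hi : i < 2 * m + 1) :
        (σ i).2.1 < 2 * m + 1 + 1 ∧ (σ i).2.2 < 2 * m + 1 + 1 := by
      obtain ⟨h5, h6⟩ := h3 i hi
      unfold LocalAt at h5
      split at h5 <;> lia
    let s : Fin (2 * m + 1) → P × Fin (2 * m + 1 + 1) × Fin (2 * m + 1 + 1) := fun i =>
      ((σ i).1, ⟨(σ i).2.1, (hle i i.2).1⟩, ⟨(σ i).2.2, (hle i i.2).2⟩)
    let a : Fin (2 * m + 1) × (P × Fin (2 * m + 1 + 1) × Fin (2 * m + 1 + 1)) → Bool :=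
      fun j => decide (j.2 = s j.1)
    have ha : cnfEval φ a = true := (H a).mpr ⟨s, fun _ _ => rfl,
      (G.forall_compat_iff (fun _ => rfl) (by lia)).mpr ⟨h3, h1, h2⟩⟩
    refine ⟨a, ?_⟩
    rw [ha, hprod s a fun _ _ => rfl, ← h4,
      ← Fin.prod_univ_eq_prod_range (fun j => eval z (G.label (σ j).1).poly)]
    simp [bit, s]

end

end Grammar

/-! ### Parse trees of circuits -/

section
variable {S : Type} [CommSemiring S]

/-- The grammar of a circuit. Its nonterminals are the gates and `none`, which stands for an empty
product. The rules are named as follows: `none` is the only rule for `none`, and a gate `k` has the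
rule `(k, 0)`, which pays the constant coefficient of the polynomial at `k` at once, the rules
`(k, 1)` and `(k, 2)`, which proceed according to the type of the gate, and the rule `(k, 3)`, which
does nothing and serves for padding. -/
noncomputable def Circuit.grammar {v : ℕ} (C : Circuit S v) :
    Grammar S v (Option (Fin C.size)) (Option (Fin C.size × Fin 4)) where
  src := Option.map Prod.fst
  body
    | none => .inl (.const 1)
    | some (k, 0) => .inl (.const (coeff 0 (C.polyAt k)))
    | some (k, 1) =>
      match C.gate k with
      | .var i => .inl (.var i)
      | .const c => .inl (.const c)
      | .sum a _ => .inr (some ⟨a, a.2.trans k.2⟩, none)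
      | .prod a b => .inr (some ⟨a, a.2.trans k.2⟩, some ⟨b, b.2.trans k.2⟩)
    | some (k, 2) =>
      match C.gate k with
      | .sum _ b => .inr (some ⟨b, b.2.trans k.2⟩, none)
      | _ => .inr (some k, none)
    | some (k, 3) => .inr (some k, none)

theorem Circuit.grammar_body_one {v : ℕ} (C : Circuit S v) (k : Fin C.size) :
    C.grammar.body (some (k, 1)) = match C.gate k with
      | .var i => .inl (.var i)
      | .const c => .inl (.const c)
      | .sum a _ => .inr (some ⟨a, a.2.trans k.2⟩, none)
      | .prod a b => .inr (some ⟨a, a.2.trans k.2⟩, some ⟨b, b.2.trans k.2⟩) := rfl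

theorem Circuit.grammar_body_two {v : ℕ} (C : Circuit S v) (k : Fin C.size) :
    C.grammar.body (some (k, 2)) = match C.gate k with
      | .sum _ b => .inr (some ⟨b, b.2.trans k.2⟩, none)
      | _ => .inr (some k, none) := rfl

end

section
variable {S : Type} [CommSemiring S] [LinearOrder S] [MinSemiring S]
open MinSemiring

theorem Circuit.isLowerBound_grammar {v : ℕ} (C : Circuit S v) (z : Fin v → S) :
    C.grammar.IsLowerBound z fun A => A.elim 1 fun k => eval z (C.polyAt k) := by
  rintro (_ | ⟨k, c⟩)
  · simp [grammar, Label.poly]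
  · obtain rfl | rfl | rfl | rfl : c = 0 ∨ c = 1 ∨ c = 2 ∨ c = 3 := by
      fin_cases c <;> simp
    · simpa [grammar, Label.poly] using eval_le_eval_monomial z (C.polyAt k) 0
    · rw [C.grammar_body_one]
      cases h : C.gate k with
      | var i => simp [grammar, Circuit.polyAt_of_gate_var h, Label.poly]
      | const c => simp [grammar, Circuit.polyAt_of_gate_const h, Label.poly]
      | sum a b =>
        simp only [grammar, Circuit.polyAt_of_gate_sum h, Option.map, Option.elim, mul_one, map_add,
          add_eq_min]
        exact min_le_left _ _
      | prod a b =>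
        simp [grammar, Circuit.polyAt_of_gate_prod h]
    · rw [C.grammar_body_two]
      cases h : C.gate k with
      | sum a b =>
        simp only [grammar, Circuit.polyAt_of_gate_sum h, Option.map, Option.elim, mul_one, map_add,
          add_eq_min]
        exact min_le_right _ _
      | var i => simp [grammar]
      | const c => simp [grammar]
      | prod a b => simp [grammar]
    · simp [grammar]

omit [LinearOrder S] [MinSemiring S] in
theorem Circuit.derives_none {v : ℕ} (C : Circuit S v) (z : Fin v → S) :
    C.grammar.Derives z none 1 0 := by
  have h : C.grammar.body none = .inl (.const 1) := rfl
  simpa [Label.poly, grammar] using Grammar.Derives.leaf (z := z) h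

omit [LinearOrder S] [MinSemiring S] in
/-- Parse trees can be enlarged, without changing the weight, by any number of inner nodes. -/
theorem Circuit.derives_padding {v : ℕ} (C : Circuit S v) (z : Fin v → S) {k : Fin C.size} {u : S}
    {m : ℕ} (h : C.grammar.Derives z (some k) u m) (n : ℕ) :
    C.grammar.Derives z (some k) u (m + n) := by
  induction n with
  | zero => exact h
  | succ n ih =>
    have hb : C.grammar.body (some (k, 3)) = .inr (some k, none) := rfl
    have h' := Grammar.Derives.branch hb ih (C.derives_none z)
    rw [mul_one, add_zero] at h'
    exact h'

omit [LinearOrder S] [MinSemiring S] in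
theorem Circuit.derives_of_gate_sum {v : ℕ} (C : Circuit S v) (z : Fin v → S) {k : Fin C.size}
    {a b : Fin k} (hk : C.gate k = .sum a b) {u : S} {m : ℕ}
    (h : C.grammar.Derives z (some ⟨a, a.2.trans k.2⟩) u m ∨
      C.grammar.Derives z (some ⟨b, b.2.trans k.2⟩) u m) :
    C.grammar.Derives z (some k) u (m + 1) := by
  rcases h with h | h
  · have hb := C.grammar_body_one k
    rw [hk] at hb
    have h' := Grammar.Derives.branch hb h (C.derives_none z)
    rw [mul_one, add_zero] at h'
    exact h'
  · have hb := C.grammar_body_two k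
    rw [hk] at hb
    have h' := Grammar.Derives.branch hb h (C.derives_none z)
    rw [mul_one, add_zero] at h'
    exact h'

/-- A monomial of degree `d` at gate `k` has a parse tree with at most `d * (k + 1)` inner nodes:
along every path in the circuit the gate number decreases, and subtrees of degree zero are cut to a
single leaf. -/
theorem Circuit.exists_derives {v : ℕ} (C : Circuit S v) (z : Fin v → S) (k : ℕ)
    (hk : k < C.size) (e : Fin v →₀ ℕ) (he : coeff e (C.polyAt ⟨k, hk⟩) ≠ 0) :
    ∃ u m, m ≤ e.degree * (k + 1) ∧ C.grammar.Derives z (some ⟨k, hk⟩) u m ∧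
      u ≤ eval z (monomial e (coeff e (C.polyAt ⟨k, hk⟩))) := by
  induction k using Nat.strong_induction_on generalizing e with
  | _ k ih =>
    by_cases he0 : e = 0
    · subst he0
      have hb : C.grammar.body (some (⟨k, hk⟩, 0)) =
          .inl (.const (coeff 0 (C.polyAt ⟨k, hk⟩))) := rfl
      refine ⟨_, 0, Nat.zero_le _, .leaf hb, ?_⟩
      simp [Label.poly]
    have hdeg : 1 ≤ e.degree := by
      rw [Nat.one_le_iff_ne_zero]
      exact fun h => he0 (by simpa [Finsupp.degree_eq_zero_iff] using h)
    cases h : C.gate ⟨k, hk⟩ with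
    | var i =>
      have hb := C.grammar_body_one ⟨k, hk⟩
      rw [h] at hb
      refine ⟨_, 0, Nat.zero_le _, .leaf hb, ?_⟩
      rw [Circuit.polyAt_of_gate_var h] at he ⊢
      exact eval_le_eval_monomial z (X i) e
    | const c =>
      rw [Circuit.polyAt_of_gate_const h, coeff_C, if_neg (Ne.symm he0)] at he
      exact absurd rfl he
    | sum a b =>
      rw [Circuit.polyAt_of_gate_sum h, coeff_add, add_eq_min (S := S)] at he ⊢
      have ha' : e.degree * (a + 1) + 1 ≤ e.degree * (k + 1) := by
        have := a.2; dsimp only at this; nlinarith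
      have hb' : e.degree * (b + 1) + 1 ≤ e.degree * (k + 1) := by
        have := b.2; dsimp only at this; nlinarith
      rcases min_choice (coeff e (C.polyAt ⟨a, a.2.trans hk⟩))
        (coeff e (C.polyAt ⟨b, b.2.trans hk⟩)) with h1 | h1 <;> rw [h1] at he ⊢
      · obtain ⟨u, m, hm, hd, hu⟩ := ih a a.2 _ e he
        exact ⟨u, m + 1, by lia, C.derives_of_gate_sum z h (.inl hd), hu⟩
      · obtain ⟨u, m, hm, hd, hu⟩ := ih b b.2 _ e he
        exact ⟨u, m + 1, by lia, C.derives_of_gate_sum z h (.inr hd), hu⟩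
    | prod a b =>
      rw [Circuit.polyAt_of_gate_prod h, coeff_mul] at he ⊢
      obtain ⟨⟨e₁, e₂⟩, h12, heq⟩ := exists_eq_sum_of_ne_zero he
      rw [← heq] at he ⊢
      rw [Finset.HasAntidiagonal.mem_antidiagonal] at h12
      dsimp only at h12 he ⊢
      subst h12
      obtain ⟨u₁, m₁, hm₁, hd₁, hu₁⟩ := ih a a.2 _ e₁ (left_ne_zero_of_mul he)
      obtain ⟨u₂, m₂, hm₂, hd₂, hu₂⟩ := ih b b.2 _ e₂ (right_ne_zero_of_mul he)
      have hb := C.grammar_body_one ⟨k, hk⟩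
      rw [h] at hb
      refine ⟨u₁ * u₂, m₁ + m₂ + 1, ?_, .branch hb hd₁ hd₂, ?_⟩
      · rw [map_add] at hdeg ⊢
        have ha : e₁.degree * (a + 1) ≤ e₁.degree * k := Nat.mul_le_mul_left _ a.2
        have hb : e₂.degree * (b + 1) ≤ e₂.degree * k := Nat.mul_le_mul_left _ b.2
        nlinarith
      · rw [← monomial_mul, map_mul]
        exact mul_le_mul_of_le hu₁ hu₂

/-- The values of a polynomial of degree at most `d` that is computed by a circuit `C` are the
minimal weights of assignments satisfying a formula in conjunctive normal form. -/
theorem Circuit.exists_cnf {v : ℕ} (C : Circuit S v) {g : MvPolynomial (Fin v) S}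
    (hC : SameFunction C.poly g) {d s L : ℕ} (hd : g.totalDegree ≤ d) (hs : C.size ≤ s)
    (hL : L = 2 * (d * s) + 1) :
    ∃ (β : Type) (_ : Fintype β) (φ : List (List (β × Bool))) (ℓ : β → Label S v),
      Fintype.card β ≤ L * ((s * 4 + 1) * (L + 1) ^ 2) ∧
      (φ.map fun c => c.length + 1).sum ≤ L * ((s * 4 + 1) * (L + 1) ^ 2 + 1) +
        (L * ((s * 4 + 1) * (L + 1) ^ 2)) ^ 2 * 3 ∧
      ∀ z : Fin v → S,
        (∀ a, eval z g ≤ bit (cnfEval φ a) * ∏ j, if a j then eval z (ℓ j).poly else 1) ∧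
        ∃ a, bit (cnfEval φ a) * (∏ j, if a j then eval z (ℓ j).poly else 1) ≤ eval z g := by
  classical
  obtain ⟨φ, hφ, H⟩ := C.grammar.exists_cnf (some C.output) hL
  have hP : Fintype.card (Option (Fin C.size × Fin 4)) ≤ s * 4 + 1 := by
    simp only [Fintype.card_option, Fintype.card_prod, Fintype.card_fin]
    lia
  refine ⟨_, inferInstance, φ, fun j => C.grammar.label j.2.1, ?_, hφ.trans ?_, fun z => ⟨?_, ?_⟩⟩
  · rw [Fintype.card_prod, Fintype.card_prod, Fintype.card_prod, Fintype.card_fin, Fintype.card_fin,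
      ← sq]
    gcongr
  · gcongr
  · intro a
    rw [← hC z]
    exact (H z).1 _ (C.isLowerBound_grammar z) a
  · by_cases hz : eval z g = 0
    · exact ⟨fun _ => false, hz ▸ le_zero _⟩
    · obtain ⟨e, he, hed, hle⟩ := exists_eval_monomial_le hC hz
      obtain ⟨u, m, hm, hu, hu'⟩ := C.exists_derives z C.output C.output.2 e
        (mem_support_iff.mp he)
      have hm' : m ≤ d * s := hm.trans (Nat.mul_le_mul (hed.trans hd) (C.output.2.trans_le hs))
      obtain ⟨n, hn⟩ := Nat.exists_eq_add_of_le hm'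
      obtain ⟨a, ha⟩ := (H z).2 u (hn ▸ C.derives_padding z hu n)
      exact ⟨a, ha.le.trans (hu'.trans hle)⟩

/-! ### Hypercube sums -/

/-- A renaming of the variables of a label. -/
def Label.rename {v v' : ℕ} (f : Fin v → Fin v') : Label S v → Label S v'
  | .var i => .var (f i)
  | .const c => .const c

omit [LinearOrder S] [MinSemiring S] in
theorem Label.eval_poly_rename {v v' : ℕ} (f : Fin v → Fin v') (ℓ : Label S v) (z : Fin v' → S) :
    eval z (ℓ.rename f).poly = eval (z ∘ f) ℓ.poly := by
  cases ℓ <;> simp [Label.rename, Label.poly]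

/-- The standard numbering of the variables `(X, y_1, …, y_q, ȳ_1, …, ȳ_q)`. -/
def hypercubeEquiv (v q : ℕ) : Fin (v + (q + q)) ≃ Fin v ⊕ Fin q ⊕ Fin q :=
  finSumFinEquiv.symm.trans (Equiv.sumCongr (Equiv.refl _) finSumFinEquiv.symm)

/-- A hypercube sum over a polynomial that is computed by a circuit is a hypercube sum over a
branching program of width two. The new hypercube variables are the old ones, the variables of a
formula describing parse trees, and unused ones, which do not matter as addition is idempotent. -/
theorem exists_abp_hypercube_sum {N v q d s L Q : ℕ} (C : Circuit S N)
    {g : MvPolynomial (Fin N) S} (hC : SameFunction C.poly g) (hd : g.totalDegree ≤ d)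
    (hs : C.size ≤ s) (e : Fin N ≃ Fin v ⊕ Fin q ⊕ Fin q) (hL : L = 2 * (d * s) + 1)
    (hQ : q + L * ((s * 4 + 1) * (L + 1) ^ 2) ≤ Q) :
    ∃ A : ABP S 2 (v + (Q + Q)), A.length ≤ Q + L + Q ^ 2 * 3 + 2 * Q ∧
      ∀ x : Fin v → S,
        ∑ b : Fin q → Bool, eval (fun i => hypercubePoint x b (e i)) g =
          ∑ b : Fin Q → Bool, eval (fun i => hypercubePoint x b (hypercubeEquiv v Q i)) A.poly := by
  classical
  obtain ⟨β, _, φ, ℓ, hβ, hφ, H⟩ := C.exists_cnf hC hd hs hL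
  have hcard : Fintype.card (Fin q ⊕ β) ≤ Fintype.card (Fin Q) := by
    rw [Fintype.card_sum, Fintype.card_fin, Fintype.card_fin]
    exact (Nat.add_le_add_left hβ q).trans hQ
  obtain ⟨ι⟩ := Function.Embedding.nonempty_of_card_le hcard
  let E := (hypercubeEquiv v Q).symm
  let old : Fin N → Fin (v + (Q + Q)) := fun i =>
    E (Sum.map id (Sum.map (ι ∘ .inl) (ι ∘ .inl)) (e i))
  obtain ⟨A, hA, hA'⟩ := exists_abp_cnf φ (fun j => E (.inr (.inl (ι (.inr j)))))
    (fun j => E (.inr (.inr (ι (.inr j))))) fun j => (ℓ j).rename old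
  have hT : L * ((s * 4 + 1) * (L + 1) ^ 2) ≤ Q := (Nat.le_add_left _ _).trans hQ
  have hlen : A.length ≤ Q + L + Q ^ 2 * 3 + 2 * Q := by
    rw [hA]
    rw [mul_add_one] at hφ
    refine Nat.add_le_add (hφ.trans ?_) (Nat.mul_le_mul_left 2 (hβ.trans hT))
    gcongr
  refine ⟨A, hlen, fun x => ?_⟩
  have hpt (b : Fin Q → Bool) : (fun i => hypercubePoint x b (hypercubeEquiv v Q i)) ∘ old =
      fun i => hypercubePoint (S := S) x (b ∘ ι ∘ .inl) (e i) := by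
    funext i
    simp only [Function.comp_apply, old, E, Equiv.apply_symm_apply]
    rcases e i with i | i | i <;> rfl
  have key (b : Fin Q → Bool) :
      eval (fun i => hypercubePoint x b (hypercubeEquiv v Q i)) A.poly =
        bit (cnfEval φ (b ∘ ι ∘ .inr)) * ∏ j, if (b ∘ ι ∘ .inr) j then
          eval (fun i => hypercubePoint x (b ∘ ι ∘ .inl) (e i)) (ℓ j).poly else 1 := by
    rw [hA' _ (b ∘ ι ∘ .inr)]
    · simp only [Label.eval_poly_rename, hpt]
    · intro j
      simp [E, hypercubePoint]
    · intro j
      simp [E, hypercubePoint]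
  apply le_antisymm
  · refine le_sum fun b _ => ?_
    rw [key]
    exact (sum_le (fun b : Fin q → Bool => eval (fun i => hypercubePoint x b (e i)) g)
      (Finset.mem_univ (b ∘ ι ∘ .inl))).trans ((H _).1 _)
  · refine le_sum fun b _ => ?_
    obtain ⟨a, ha⟩ := (H fun i => hypercubePoint x b (e i)).2
    let b' : Fin Q → Bool := Function.extend ι (Sum.elim b a) fun _ => false
    have hb' (j) : b' (ι j) = Sum.elim b a j := ι.injective.extend_apply _ _ _
    have h1 : b' ∘ ι ∘ .inl = b := funext fun j => hb' (.inl j)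
    have h2 : b' ∘ ι ∘ .inr = a := funext fun j => hb' (.inr j)
    refine (sum_le (fun b : Fin Q → Bool =>
      eval (fun i => hypercubePoint x b (hypercubeEquiv v Q i)) A.poly)
      (Finset.mem_univ b')).trans ?_
    rw [key, h1, h2]
    exact ha

theorem VNP_eq_VNBP_two : VNP S = VNBP S 2 := by
  refine Set.Subset.antisymm ?_ (hypercubeSums_mono VBP_two_subset_VP)
  rintro f ⟨hf, g, ⟨⟨_, Pd, hPd⟩, C, ⟨Ps, hPs⟩, hC⟩, p, q, H⟩
  choose m hm e he using H
  let D : Polynomial ℕ := Pd.comp p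
  let Z : Polynomial ℕ := Ps.comp p
  let L : Polynomial ℕ := 2 * (D * Z) + 1
  let Q : Polynomial ℕ := q + L * ((Z * 4 + 1) * (L + 1) ^ 2)
  have hD (n : ℕ+) : (g.poly (m n)).totalDegree ≤ D.eval (n : ℕ) := by
    rw [Polynomial.eval_comp, ← hm n]; exact hPd _
  have hZ (n : ℕ+) : (C (m n)).size ≤ Z.eval (n : ℕ) := by
    rw [Polynomial.eval_comp, ← hm n]; exact hPs _
  choose A hA hA' using fun n : ℕ+ => exists_abp_hypercube_sum (L := L.eval (n : ℕ))
    (Q := Q.eval (n : ℕ)) (C (m n)) (hC (m n)) (hD n) (hZ n) (e n) (by simp [L])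
    (by simp [Q])
  let B : Polynomial ℕ := Q + L + Q ^ 2 * 3 + 2 * Q
  have hB (n : ℕ+) : (A n).length ≤ B.eval (n : ℕ) := by simpa [B] using hA n
  obtain ⟨Pf, hPf⟩ := hf.1
  refine ⟨hf, ⟨fun n => f.arity n + (Q.eval (n : ℕ) + Q.eval (n : ℕ)), fun n => (A n).poly⟩,
    ⟨⟨⟨Pf + (Q + Q), fun n => ?_⟩, ⟨B, fun n => (A n).totalDegree_poly_le.trans (hB n)⟩⟩,
      A, ⟨2 * (B + 1), fun n => ?_⟩, fun n x => rfl⟩,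
    .X, Q, fun n => ⟨n, by simp, hypercubeEquiv _ _, fun x => ?_⟩⟩
  · simpa using hPf n
  · simpa [ABP.size] using hB n
  · rw [he n x]
    exact hA' n x

end

end MinPlus

theorem mainTheorem7 :
    MinPlus.VNP MinPlus.R = MinPlus.VNBP MinPlus.R 2 ∧
      MinPlus.VNP MinPlus.RPlus = MinPlus.VNBP MinPlus.RPlus 2 := by
  exact ⟨MinPlus.VNP_eq_VNBP_two, MinPlus.VNP_eq_VNBP_two⟩
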